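/- Let $\mathcal H\cong L^2(\mathbb R)$ be the Hilbert space of a single bosonic mode with Fock basis $(|n\rangle)_{n\ge 0}$, annihilation operator $\mathbf a|n\rangle=\sqrt n\,|n-1\rangle$ and quadratures $\mathbf R=(\mathbf R_1,\mathbf R_2)^\top=(\mathbf x,\mathbf p)^\top$, where $\mathbf a=(\mathbf x+i\mathbf p)/\sqrt2$ and $\mathbf a^\dagger=(\mathbf x-i\mathbf p)/\sqrt2$. Let $\mathbf N=\mathbf a^\dagger\mathbf a$ and $\Omega=\begin{pmatrix}0&1\\-1&0\end{pmatrix}$. For a trace-class operator $T$ and a polynomial $A$ in the quadratures, $\mathrm{Tr}[TA]$ denotes $\sum_n\langle n|TA|n\rangle$ when this series converges absolutely. The moment of $T$ of order $\kappa$ is called finite if $\sum_n n^{\kappa/2}\,|\langle n|T|n\rangle|<\infty$, i.e. if the series for $\mathrm{Tr}[T\mathbf N^{\kappa/2}]$ converges absolutely. Let $\mathcal N$ be a single-mode bosonic quantum channel, i.e. a completely positive trace-preserving linear map on the trace-class operators on $\mathcal H$. Suppose that $\mathcal N$ is centered, i.e. $\mathrm{Tr}[\mathcal N(|0\rangle\langle0|)\,\mathbf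 R_j]=0$ for $j=1,2$, that $\mathcal N(|0\rangle\langle 0|)$ has a finite second-order moment, and that $\mathcal N(|1\rangle\langle 0|)$ has a finite first-order moment. Put $$X_{j1}=\tfrac1{\sqrt2}\mathrm{Tr}\big[\mathcal N(|0\rangle\langle1|+|1\rangle\langle0|)\,\mathbf R_j\big],\qquad X_{j2}=\tfrac1{\sqrt2}\mathrm{Tr}\big[\mathcal N(-i|0\rangle\langle1|+i|1\rangle\langle0|)\,\mathbf R_j\big]\qquad(j=1,2),$$ $$Y=V-XX^\top,$$ where $V$ is the covariance matrix of $\mathcal N(|0\rangle\langle0|)$: $V_{jk}=\mathrm{Tr}[\mathcal N(|0\rangle\langle0|)\{\mathbf R_j-d_j,\mathbf R_k-d_k\}]$, with $d_j=\mathrm{Tr}[\mathcal N(|0\rangle\langle0|)\mathbf R_j]$ and $\{\cdot,\cdot\}$ the anticommutator. These are the matrices of the Gaussification of $\mathcal N$. Then $X$ and $Y$ are well-defined real $2\times2$ matrices, and $$Y+i\,\Omega\;\ge\; i\,X\Omega X^\top,$$ in the sense that the complex matrix $Y+i\Omega-iX\Omega X^\top$ is Hermitian and positive semidefinite. -/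

import Mathlib

open scoped ComplexOrder InnerProductSpace

/-- The Hilbert space of a single bosonic mode, in its number (Fock) representation: the
square-summable sequences indexed by the photon number. The Hermite basis identifies it with
the square-integrable functions on the real line. -/
abbrev FockSpace : Type := lp (fun _ : ℕ => ℂ) 2

namespace Bosonic

noncomputable section

/-- The Fock state with `n` photons. -/
def ket (n : ℕ) : FockSpace := lp.single 2 n (1 : ℂ)

/-! ### Trace-class operators -/

/-- A positive operator of finite trace. -/
def IsPosFiniteTrace (T : FockSpace →L[ℂ] FockSpace) : Prop :=
  T.IsPositive ∧ Summable fun n : ℕ => ⟪ket n, T (ket n)⟫_ℂ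

/-- The space of trace-class operators: the complex linear combinations of positive
operators of finite trace. -/
def TraceClass : Submodule ℂ (FockSpace →L[ℂ] FockSpace) :=
  Submodule.span ℂ {T | IsPosFiniteTrace T}

/-- The trace of a trace-class operator. -/
def trace (T : TraceClass) : ℂ := ∑' n : ℕ, ⟪ket n, T.1 (ket n)⟫_ℂ

/-- A vector outer product with itself is positive and has finite trace. -/
theorem isPosFiniteTrace_rankOne_self (u : FockSpace) :
    IsPosFiniteTrace (InnerProductSpace.rankOne ℂ u u) := by
  refine ⟨InnerProductSpace.isPositive_rankOne_self u, ?_⟩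
  have h : Summable fun n : ℕ => ‖u n‖ ^ (2 : ℝ) := by
    have := lp.memℓp u
    rw [memℓp_gen_iff (by norm_num)] at this
    simpa using this
  refine Summable.of_norm ?_
  refine h.congr fun n => ?_
  simp only [InnerProductSpace.rankOne_apply, inner_smul_right, ket, lp.inner_single_left,
    lp.inner_single_right, norm_mul]
  simp [sq]

/-- Every rank-one operator `|u⟩⟨v|` is of trace class. -/
theorem rankOne_mem_traceClass (u v : FockSpace) :
    InnerProductSpace.rankOne ℂ u v ∈ TraceClass := by
  have key : ∀ w : FockSpace, InnerProductSpace.rankOne ℂ w w ∈ TraceClass := fun w =>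
    Submodule.subset_span (isPosFiniteTrace_rankOne_self w)
  have e : InnerProductSpace.rankOne ℂ u v = (1 / 4 : ℂ) •
      (InnerProductSpace.rankOne ℂ (u + v) (u + v) - InnerProductSpace.rankOne ℂ (u - v) (u - v)
        + Complex.I • InnerProductSpace.rankOne ℂ (u + Complex.I • v) (u + Complex.I • v)
        - Complex.I • InnerProductSpace.rankOne ℂ (u - Complex.I • v) (u - Complex.I • v)) := by
    ext1 w
    simp only [InnerProductSpace.rankOne_apply, smul_apply,
      add_apply, sub_apply, inner_add_left,
      inner_sub_left, inner_smul_left, Complex.conj_I]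
    match_scalars <;> ring_nf <;> simp only [Complex.I_sq] <;> ring
  rw [e]
  exact TraceClass.smul_mem _ (TraceClass.sub_mem (TraceClass.add_mem
    (TraceClass.sub_mem (key _) (key _)) (TraceClass.smul_mem _ (key _)))
    (TraceClass.smul_mem _ (key _)))

/-- The trace-class operator `|m⟩⟨n|`. -/
def ketbra (m n : ℕ) : TraceClass :=
  ⟨InnerProductSpace.rankOne ℂ (ket m) (ket n), rankOne_mem_traceClass _ _⟩

/-! ### Quadratures and moments -/

/-- Finite linear combinations of Fock states, an invariant core for the quadratures. -/
abbrev FiniteFock : Type := ℕ →₀ ℂ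

/-- The inclusion of the finite linear combinations of Fock states into the Hilbert space. -/
def incl : FiniteFock →ₗ[ℂ] FockSpace := Finsupp.linearCombination ℂ ket

/-- The annihilation operator, `a |n⟩ = √n |n - 1⟩` (so `a |0⟩ = 0`). -/
def annihilation : Module.End ℂ FiniteFock :=
  Finsupp.linearCombination ℂ fun n : ℕ => Finsupp.single (n - 1) ((Real.sqrt n : ℝ) : ℂ)

/-- The creation operator, `a† |n⟩ = √(n + 1) |n + 1⟩`. -/
def creation : Module.End ℂ FiniteFock :=
  Finsupp.linearCombination ℂ fun n : ℕ => Finsupp.single (n + 1) ((Real.sqrt (n + 1) : ℝ) : ℂ)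

/-- The quadratures `R = (x, p)`, determined by `a = (x + i p) / √2`, `a† = (x - i p) / √2`. -/
def quadrature : Fin 2 → Module.End ℂ FiniteFock :=
  ![(1 / (Real.sqrt 2 : ℂ)) • (annihilation + creation),
    (1 / (Complex.I * (Real.sqrt 2 : ℂ))) • (annihilation - creation)]

/-- `Tr[T A] = t` for a polynomial `A` in the quadratures: the series `∑ₙ ⟨n| T A |n⟩` converges
(unconditionally, hence absolutely) to `t`. -/
def HasTrace (T : TraceClass) (A : Module.End ℂ FiniteFock) (t : ℂ) : Prop :=
  HasSum (fun n : ℕ => ⟪ket n, T.1 (incl (A (Finsupp.single n 1)))⟫_ℂ) t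

/-- `d` is the vector of first-order moments `Tr[ρ R]`. -/
def HasFirstMoments (ρ : TraceClass) (d : Fin 2 → ℝ) : Prop :=
  ∀ j, HasTrace ρ (quadrature j) (d j : ℂ)

/-- `ρ` is centered: its vector of first-order moments is zero. -/
def IsCentered (ρ : TraceClass) : Prop := HasFirstMoments ρ 0

/-- `V` is the covariance matrix `Tr[ρ {R - d, (R - d)ᵀ}]`, with `d` the first-order moments. -/
def HasCovariance (ρ : TraceClass) (V : Matrix (Fin 2) (Fin 2) ℝ) : Prop :=
  ∃ d : Fin 2 → ℝ, HasFirstMoments ρ d ∧ ∀ j k,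
    HasTrace ρ
      ((quadrature j - (d j : ℂ) • 1) * (quadrature k - (d k : ℂ) • 1)
        + (quadrature k - (d k : ℂ) • 1) * (quadrature j - (d j : ℂ) • 1))
      (V j k : ℂ)

/-- The moment `Tr[T N^(κ/2)]` of order `κ` is finite, where `N |n⟩ = n |n⟩` is the photon number:
the series `∑ₙ n^(κ/2) ⟨n| T |n⟩` converges absolutely. -/
def HasFiniteMoment (κ : ℝ) (T : TraceClass) : Prop :=
  Summable fun n : ℕ => (n : ℝ) ^ (κ / 2) * ‖⟪ket n, T.1 (ket n)⟫_ℂ‖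

/-! ### Channels -/

/-- The operator `∑ᵢⱼ Tᵢⱼ ⊗ |i⟩⟨j|` on the tensor product of the mode with a `k`-level system
is positive semidefinite. -/
def BlockPositive {k : ℕ} (T : Fin k → Fin k → TraceClass) : Prop :=
  ∀ v : Fin k → FockSpace, 0 ≤ ∑ i, ∑ j, ⟪v i, (T i j).1 (v j)⟫_ℂ

/-- A single-mode bosonic quantum channel: a completely positive, trace-preserving linear map
on the trace-class operators. -/
structure Channel where
  /-- The underlying linear map. -/
  map : TraceClass →ₗ[ℂ] TraceClass
  completelyPositive : ∀ (k : ℕ) (T : Fin k → Fin k → TraceClass),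
    BlockPositive T → BlockPositive fun i j => map (T i j)
  tracePreserving : ∀ T, trace (map T) = trace T

/-- The channel is centered: its output on the vacuum state is centered. -/
def Channel.IsCentered (N : Channel) : Prop := Bosonic.IsCentered (N.map (ketbra 0 0))

/-- The symplectic form. -/
def Omega : Matrix (Fin 2) (Fin 2) ℝ := !![0, 1; -1, 0]

/-- The two Hermitian operators `|0⟩⟨1| + |1⟩⟨0|` and `-i|0⟩⟨1| + i|1⟩⟨0|`. -/
def transition : Fin 2 → TraceClass :=
  ![ketbra 0 1 + ketbra 1 0, (-Complex.I) • ketbra 0 1 + Complex.I • ketbra 1 0]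

/-- `X` and `Y` are the matrices of the Gaussification of the channel:
`X j k = (1 / √2) Tr[R j * N(transition k)]`, and `Y = V - X Xᵀ` where `V` is the covariance
matrix of the output on the vacuum state. -/
def Channel.HasGaussificationMatrices (N : Channel) (X Y : Matrix (Fin 2) (Fin 2) ℝ) : Prop :=
  (∀ j k, HasTrace (N.map (transition k)) ((1 / (Real.sqrt 2 : ℂ)) • quadrature j) (X j k : ℂ)) ∧
  ∃ V : Matrix (Fin 2) (Fin 2) ℝ, HasCovariance (N.map (ketbra 0 0)) V ∧ Y = V - X * X.transpose

/-- A real matrix viewed as a complex one. -/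
def toComplex (M : Matrix (Fin 2) (Fin 2) ℝ) : Matrix (Fin 2) (Fin 2) ℂ :=
  M.map (fun r : ℝ => (r : ℂ))

end

end Bosonic

/-!
Write `ρ = N(|0⟩⟨0|)` and `σ = N(|0⟩⟨1|)`. The quadratic form of `Y + iΩ - iXΩXᵀ` at `c` is
`c†(V + iΩ)c - c†X(1 + iΩ)Xᵀc`. By the canonical commutation relation the first term is
`2 Tr[ρ L†L]` with `L = c₀ x + c₁ p`; since `1 + iΩ = w w†` with `w = (1, -i)`, and
`X_{j1} + i X_{j2} = √2 Tr[σ Rⱼ]`, the second one is `2 |Tr[σ L]|²`. The claim is therefore the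
Cauchy–Schwarz inequality `|Tr[σ L]|² ≤ Tr[ρ L†L] Tr[N(|1⟩⟨1|)]`, in which the last factor is `1`
because `N` preserves the trace.

This inequality follows from the positivity of the `2 × 2` block operator `(N(|i⟩⟨j|))ᵢⱼ`
(`Channel.block_positive`), a case of complete positivity: the block operator is tested on the
vectors `L†|n⟩` and `z|n⟩`, with a scalar `z` that does not depend on `n`, and the resulting
inequalities are summed over `n` (`BlockPositive.moment_inequality`).

All traces are expressed by four numbers: `p = Tr[ρ a†a]`, `q = Tr[ρ a²]`, `g = Tr[σ a]` and
`k = Tr[σ a†]`. Their series converge absolutely because block positivity gives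
`√x √y |σₘₙ| ≤ x ρₘₘ + y N(|1⟩⟨1|)ₙₙ` (`BlockPositive.norm_mul_fockEntry_le`), which bounds them by
the energy `p` and by traces. The matrices `X` and `V` are `gaussX g k` and `gaussV p q`, and
`posSemidef_gauss` identifies the quadratic form.
-/

open scoped ComplexOrder InnerProductSpace
open ComplexConjugate

namespace Bosonic

/-! ### Matrix elements and traces in the Fock basis -/

/-- The matrix element `⟨m| T |n⟩` in the Fock basis. -/
noncomputable def fockEntry (T : TraceClass) (m n : ℕ) : ℂ := ⟪ket m, T.1 (ket n)⟫_ℂ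

@[simp] theorem incl_single (n : ℕ) (c : ℂ) : incl (Finsupp.single n c) = c • ket n := by
  simp [incl]

@[simp] theorem annihilation_single (n : ℕ) (c : ℂ) :
    annihilation (Finsupp.single n c) =
      Finsupp.single (n - 1) (c * ((Real.sqrt n : ℝ) : ℂ)) := by
  simp [annihilation]

@[simp] theorem creation_single (n : ℕ) (c : ℂ) :
    creation (Finsupp.single n c) =
      Finsupp.single (n + 1) (c * ((Real.sqrt (n + 1) : ℝ) : ℂ)) := by
  simp [creation]

theorem inner_ket_of_ne {m n : ℕ} (h : m ≠ n) : ⟪ket m, ket n⟫_ℂ = 0 := by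
  simp [ket, lp.inner_single_left, h]

theorem HasTrace.unique {T : TraceClass} {A : Module.End ℂ FiniteFock} {s t : ℂ}
    (hs : HasTrace T A s) (ht : HasTrace T A t) : s = t := HasSum.unique hs ht

theorem HasTrace.add {T : TraceClass} {A B : Module.End ℂ FiniteFock} {s t : ℂ}
    (hs : HasTrace T A s) (ht : HasTrace T B t) : HasTrace T (A + B) (s + t) := by
  simpa [HasTrace, inner_add_right] using HasSum.add hs ht

theorem HasTrace.smul {T : TraceClass} {A : Module.End ℂ FiniteFock} {s : ℂ} (c : ℂ)
    (hs : HasTrace T A s) : HasTrace T (c • A) (c * s) := by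
  simpa [HasTrace, inner_smul_right] using HasSum.mul_left c hs

theorem HasTrace.sub {T : TraceClass} {A B : Module.End ℂ FiniteFock} {s t : ℂ}
    (hs : HasTrace T A s) (ht : HasTrace T B t) : HasTrace T (A - B) (s - t) := by
  simpa [HasTrace, inner_sub_right] using HasSum.sub hs ht

theorem HasTrace.add_state {S T : TraceClass} {A : Module.End ℂ FiniteFock} {s t : ℂ}
    (hs : HasTrace S A s) (ht : HasTrace T A t) : HasTrace (S + T) A (s + t) := by
  simpa [HasTrace, inner_add_right] using HasSum.add hs ht

theorem HasTrace.smul_state {T : TraceClass} {A : Module.End ℂ FiniteFock} {s : ℂ} (c : ℂ)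
    (hs : HasTrace T A s) : HasTrace (c • T) A (c * s) := by
  simpa [HasTrace, inner_smul_right] using HasSum.mul_left c hs

/-- A vanishing first term may be dropped from a series. -/
theorem hasSum_of_succ {f : ℕ → ℂ} {s : ℂ} (h0 : f 0 = 0)
    (h : HasSum (fun n => f (n + 1)) s) : HasSum f s := by
  have := (hasSum_nat_add_iff (f := f) 1).1 h
  simpa [h0] using this

/-- The series for `Tr[T a]`, with its vanishing vacuum term dropped. -/
theorem hasTrace_annihilation {T : TraceClass} {g : ℂ}
    (h : HasSum (fun n : ℕ => (Real.sqrt (n + 1) : ℂ) * fockEntry T (n + 1) n) g) :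
    HasTrace T annihilation g := by
  refine hasSum_of_succ (by simp) ?_
  simpa [inner_smul_right, fockEntry, -Complex.coe_smul] using h

theorem hasTrace_creation {T : TraceClass} {g : ℂ}
    (h : HasSum (fun n : ℕ => (Real.sqrt (n + 1) : ℂ) * fockEntry T n (n + 1)) g) :
    HasTrace T creation g := by
  simpa [HasTrace, inner_smul_right, fockEntry, -Complex.coe_smul] using h

theorem ofReal_sqrt_mul_self {x : ℝ} (hx : 0 ≤ x) :
    (Real.sqrt x : ℂ) * (Real.sqrt x : ℂ) = x := by
  rw [← Complex.ofReal_mul, Real.mul_self_sqrt hx]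

theorem hasTrace_creation_mul_annihilation {T : TraceClass} {p : ℂ}
    (h : HasSum (fun n : ℕ => (n : ℂ) * fockEntry T n n) p) :
    HasTrace T (creation * annihilation) p := by
  refine HasSum.congr_fun h fun n => ?_
  rcases n with _ | n
  · simp
  · have := ofReal_sqrt_mul_self (x := (n : ℝ) + 1) (by positivity)
    simp [fockEntry, this, -Complex.coe_smul, -Finsupp.single_mul]
    ring

theorem hasTrace_annihilation_mul_creation {T : TraceClass} {p : ℂ}
    (h : HasSum (fun n : ℕ => ((n : ℂ) + 1) * fockEntry T n n) p) :
    HasTrace T (annihilation * creation) p := by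
  refine HasSum.congr_fun h fun n => ?_
  have := ofReal_sqrt_mul_self (x := (n : ℝ) + 1) (by positivity)
  simp [fockEntry, this, -Complex.coe_smul, -Finsupp.single_mul]
  ring

theorem hasTrace_annihilation_mul_annihilation {T : TraceClass} {q : ℂ}
    (h : HasSum (fun n : ℕ => ((Real.sqrt (n + 1) : ℂ) * (Real.sqrt (n + 2) : ℂ))
      * fockEntry T (n + 2) n) q) :
    HasTrace T (annihilation * annihilation) q := by
  refine hasSum_of_succ (by simp) (hasSum_of_succ (by simp) ?_)
  refine HasSum.congr_fun h fun n => ?_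
  have e : (n : ℝ) + 1 + 1 = n + 2 := by ring
  simp [fockEntry, e, mul_comm, -Complex.coe_smul, -Finsupp.single_mul]

theorem hasTrace_creation_mul_creation {T : TraceClass} {q : ℂ}
    (h : HasSum (fun n : ℕ => ((Real.sqrt (n + 1) : ℂ) * (Real.sqrt (n + 2) : ℂ))
      * fockEntry T n (n + 2)) q) :
    HasTrace T (creation * creation) q := by
  refine HasSum.congr_fun h fun n => ?_
  have e : (n : ℝ) + 1 + 1 = n + 2 := by ring
  simp [fockEntry, e, -Complex.coe_smul, -Finsupp.single_mul]

/-! ### Positive two-by-two operator blocks -/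

theorem blockPositive_two_iff {T : Fin 2 → Fin 2 → TraceClass} :
    BlockPositive T ↔ ∀ u v : FockSpace, 0 ≤ ⟪u, (T 0 0).1 u⟫_ℂ + ⟪u, (T 0 1).1 v⟫_ℂ
      + (⟪v, (T 1 0).1 u⟫_ℂ + ⟪v, (T 1 1).1 v⟫_ℂ) := by
  constructor
  · intro h u v
    simpa [Fin.sum_univ_two] using h ![u, v]
  · intro h v
    simpa [Fin.sum_univ_two] using h (v 0) (v 1)

theorem BlockPositive.zero_zero_nonneg {T : Fin 2 → Fin 2 → TraceClass} (h : BlockPositive T)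
    (u : FockSpace) : 0 ≤ ⟪u, (T 0 0).1 u⟫_ℂ := by
  simpa using blockPositive_two_iff.1 h u 0

theorem BlockPositive.one_one_nonneg {T : Fin 2 → Fin 2 → TraceClass} (h : BlockPositive T)
    (v : FockSpace) : 0 ≤ ⟪v, (T 1 1).1 v⟫_ℂ := by
  simpa using blockPositive_two_iff.1 h 0 v

/-- The off-diagonal blocks of a positive block operator are adjoint to each other. -/
theorem BlockPositive.inner_one_zero {T : Fin 2 → Fin 2 → TraceClass} (h : BlockPositive T)
    (u v : FockSpace) : ⟪v, (T 1 0).1 u⟫_ℂ = conj ⟪u, (T 0 1).1 v⟫_ℂ := by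
  have h2 := blockPositive_two_iff.1 h
  have hu := (Complex.nonneg_iff.1 (h.zero_zero_nonneg u)).2
  have hv := (Complex.nonneg_iff.1 (h.one_one_nonneg v)).2
  have h1 := (Complex.nonneg_iff.1 (h2 u v)).2
  -- the imaginary part at `u` gives the imaginary parts, the one at `i u` the real parts
  have hI := (Complex.nonneg_iff.1 (h2 (Complex.I • u) v)).2
  simp only [map_smul, inner_smul_left, inner_smul_right, Complex.conj_I] at hI
  simp only [Complex.add_im, Complex.mul_im, Complex.mul_re, Complex.neg_re, Complex.neg_im,
    Complex.I_re, Complex.I_im] at h1 hI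
  apply Complex.ext
  · simp only [Complex.conj_re]; linarith
  · simp only [Complex.conj_im]; linarith

/-- The Cauchy–Schwarz bound on the off-diagonal block, with the geometric mean of the diagonal
terms replaced by the arithmetic one. -/
theorem BlockPositive.norm_zero_one_le {T : Fin 2 → Fin 2 → TraceClass} (h : BlockPositive T)
    (u v : FockSpace) :
    2 * ‖⟪u, (T 0 1).1 v⟫_ℂ‖ ≤ ‖⟪u, (T 0 0).1 u⟫_ℂ‖ + ‖⟪v, (T 1 1).1 v⟫_ℂ‖ := by
  set w := ⟪u, (T 0 1).1 v⟫_ℂ with hw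
  rcases eq_or_ne w 0 with h0 | h0
  · rw [h0]; simp; positivity
  -- rotate `v` by the phase that makes the off-diagonal terms negative
  set z : ℂ := -(conj w / ‖w‖) with hz
  have hn : (‖w‖ : ℂ) ≠ 0 := by simpa using h0
  have hww : w * conj w = (‖w‖ : ℂ) ^ 2 := Complex.mul_conj' w
  have hzz : conj z * z = 1 := by
    simp only [hz, map_neg, map_div₀, Complex.conj_conj, Complex.conj_ofReal]
    field_simp
    linear_combination hww
  have hzw : z * w = -(‖w‖ : ℂ) := by
    simp only [hz]
    field_simp
    linear_combination -hww
  have hzw' : conj z * conj w = -(‖w‖ : ℂ) := by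
    rw [← map_mul, hzw]; simp
  have h2 := blockPositive_two_iff.1 h u (z • v)
  simp only [map_smul, inner_smul_left, inner_smul_right] at h2
  rw [h.inner_one_zero, ← hw, ← mul_assoc z, mul_comm z (conj z)] at h2
  have e1 := (Complex.norm_of_nonneg' (h.zero_zero_nonneg u))
  have e2 := (Complex.norm_of_nonneg' (h.one_one_nonneg v))
  rw [hzw, hzw', hzz, one_mul, ← e1, ← e2] at h2
  have h3 : (0 : ℂ) ≤ ((‖⟪u, (T 0 0).1 u⟫_ℂ‖ + -‖w‖
    + (-‖w‖ + ‖⟪v, (T 1 1).1 v⟫_ℂ‖) : ℝ) : ℂ) := by push_cast; exact h2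
  have := Complex.zero_le_real.1 h3
  linarith

/-! ### Moments of positive blocks -/

/-- A positive operator, copied into all four blocks, gives a positive block operator. -/
theorem BlockPositive.const_zero_zero {T : Fin 2 → Fin 2 → TraceClass} (h : BlockPositive T) :
    BlockPositive fun _ _ : Fin 2 => T 0 0 := by
  refine blockPositive_two_iff.2 fun u v => ?_
  have := h.zero_zero_nonneg (u + v)
  simp only [map_add, inner_add_left, inner_add_right] at this
  convert this using 1
  ring

theorem BlockPositive.fockEntry_one_zero {T : Fin 2 → Fin 2 → TraceClass} (h : BlockPositive T)
    (m n : ℕ) : fockEntry (T 1 0) m n = conj (fockEntry (T 0 1) n m) :=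
  h.inner_one_zero _ _

/-- The weighted bound on the Fock entries of the off-diagonal block from which the convergence of
the moment series follows. -/
theorem BlockPositive.norm_mul_fockEntry_le {T : Fin 2 → Fin 2 → TraceClass}
    (h : BlockPositive T) {x y : ℝ} (hx : 0 ≤ x) (hy : 0 ≤ y) (m n : ℕ) :
    ‖(Real.sqrt x : ℂ) * (Real.sqrt y : ℂ) * fockEntry (T 0 1) m n‖
      ≤ x * ‖fockEntry (T 0 0) m m‖ + y * ‖fockEntry (T 1 1) n n‖ := by
  have h1 := h.norm_zero_one_le ((Real.sqrt x : ℂ) • ket m) ((Real.sqrt y : ℂ) • ket n)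
  simp only [map_smul, inner_smul_left, inner_smul_right, Complex.conj_ofReal, norm_mul,
    Complex.norm_real, Real.norm_of_nonneg (Real.sqrt_nonneg _), ← mul_assoc,
    Real.mul_self_sqrt hx, Real.mul_self_sqrt hy] at h1
  simp only [fockEntry, norm_mul, Complex.norm_real, Real.norm_of_nonneg (Real.sqrt_nonneg _)]
  have : 0 ≤ Real.sqrt x * Real.sqrt y * ‖⟪ket m, (T 0 1).1 (ket n)⟫_ℂ‖ := by positivity
  linarith

section Moments

variable {T : Fin 2 → Fin 2 → TraceClass}

theorem summable_succ_mul_norm {S : TraceClass}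
    (h1 : Summable fun n : ℕ => (n : ℝ) * ‖fockEntry S n n‖)
    (h0 : Summable fun n : ℕ => fockEntry S n n) :
    Summable fun n : ℕ => ((n : ℝ) + 1) * ‖fockEntry S n n‖ := by
  simpa [add_mul] using h1.add h0.norm

/-- The series for `Tr[T₀₁ a]` converges if `T₀₀` has finite energy. -/
theorem BlockPositive.summable_annihilation (h : BlockPositive T)
    (h1 : Summable fun n : ℕ => (n : ℝ) * ‖fockEntry (T 0 0) n n‖)
    (hD : Summable fun n : ℕ => fockEntry (T 1 1) n n) :
    Summable fun n : ℕ => (Real.sqrt (n + 1) : ℂ) * fockEntry (T 0 1) (n + 1) n := by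
  refine Summable.of_norm_bounded (((summable_nat_add_iff 1).2 h1).add hD.norm) fun n => ?_
  simpa using h.norm_mul_fockEntry_le (x := (n : ℝ) + 1) (y := 1) (by positivity) (by simp)
    (n + 1) n

/-- The series for `Tr[T₀₁ a†]` converges if `T₀₀` has finite energy. -/
theorem BlockPositive.summable_creation (h : BlockPositive T)
    (h1 : Summable fun n : ℕ => (n : ℝ) * ‖fockEntry (T 0 0) n n‖)
    (h0 : Summable fun n : ℕ => fockEntry (T 0 0) n n)
    (hD : Summable fun n : ℕ => fockEntry (T 1 1) n n) :
    Summable fun n : ℕ => (Real.sqrt (n + 1) : ℂ) * fockEntry (T 0 1) n (n + 1) := by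
  refine Summable.of_norm_bounded ((summable_succ_mul_norm h1 h0).add
    ((summable_nat_add_iff 1).2 hD.norm)) fun n => ?_
  simpa using h.norm_mul_fockEntry_le (x := (n : ℝ) + 1) (y := 1) (by positivity) (by simp)
    n (n + 1)

/-- The series for `Tr[T₀₀ a²]` converges if `T₀₀` has finite energy. -/
theorem BlockPositive.summable_annihilation_sq (h : BlockPositive T)
    (h1 : Summable fun n : ℕ => (n : ℝ) * ‖fockEntry (T 0 0) n n‖)
    (h0 : Summable fun n : ℕ => fockEntry (T 0 0) n n) :
    Summable fun n : ℕ => ((Real.sqrt (n + 1) : ℂ) * (Real.sqrt (n + 2) : ℂ))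
      * fockEntry (T 0 0) (n + 2) n := by
  refine Summable.of_norm_bounded (((summable_nat_add_iff 2).2 h1).add
    (summable_succ_mul_norm h1 h0)) fun n => ?_
  have := h.const_zero_zero.norm_mul_fockEntry_le (x := (n : ℝ) + 2) (y := (n : ℝ) + 1)
    (by positivity) (by positivity) (n + 2) n
  rw [mul_comm (Real.sqrt _ : ℂ)] at this
  simpa using this

/-- The Cauchy–Schwarz inequality `|Tr[T₀₁ L]|² ≤ Tr[T₀₀ L†L] Tr[T₁₁]` for `L = α a + β a†` and
`Tr[T₁₁] = 1`, with the traces of the monomials in `a` and `a†` inserted. -/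
theorem BlockPositive.moment_inequality (h : BlockPositive T) {p q g k : ℂ} (α β : ℂ)
    (h0 : HasSum (fun n : ℕ => fockEntry (T 0 0) n n) 1)
    (hD : HasSum (fun n : ℕ => fockEntry (T 1 1) n n) 1)
    (hp : HasSum (fun n : ℕ => (n : ℂ) * fockEntry (T 0 0) n n) p)
    (hq : HasSum (fun n : ℕ => ((Real.sqrt (n + 1) : ℂ) * (Real.sqrt (n + 2) : ℂ))
      * fockEntry (T 0 0) (n + 2) n) q)
    (hg : HasSum (fun n : ℕ => (Real.sqrt (n + 1) : ℂ) * fockEntry (T 0 1) (n + 1) n) g)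
    (hk : HasSum (fun n : ℕ => (Real.sqrt (n + 1) : ℂ) * fockEntry (T 0 1) n (n + 1)) k) :
    0 ≤ α * conj α * p + β * conj β * (p + 1) + (α * conj β * q + conj α * β * conj q)
      - (α * g + β * k) * conj (α * g + β * k) := by
  set w := α * g + β * k with hw
  have hsym (m n : ℕ) : fockEntry (T 0 0) m n = conj (fockEntry (T 0 0) n m) :=
    h.const_zero_zero.fockEntry_one_zero m n
  -- the four contributions to `Tr[L T₀₀ L†]`
  have s1 : HasSum (fun n : ℕ => ((n : ℂ) + 1) * fockEntry (T 0 0) (n + 1) (n + 1)) p := by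
    have := (hasSum_nat_add_iff' (f := fun n : ℕ => (n : ℂ) * fockEntry (T 0 0) n n) 1).2 hp
    simpa using this
  have s2 : HasSum (fun n : ℕ => (n : ℂ) * fockEntry (T 0 0) (n - 1) (n - 1)) (p + 1) := by
    refine hasSum_of_succ (by simp) ?_
    simpa [add_mul] using hp.add h0
  have s3 : HasSum (fun n : ℕ => (Real.sqrt n : ℂ) * (Real.sqrt (n + 1) : ℂ)
      * fockEntry (T 0 0) (n + 1) (n - 1)) q := by
    refine hasSum_of_succ (by simp) ?_
    refine HasSum.congr_fun hq fun n => ?_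
    have e : (n : ℝ) + 1 + 1 = n + 2 := by ring
    simp [e]
  have s4 : HasSum (fun n : ℕ => (Real.sqrt n : ℂ) * (Real.sqrt (n + 1) : ℂ)
      * fockEntry (T 0 0) (n - 1) (n + 1)) (conj q) := by
    refine HasSum.congr_fun (Complex.hasSum_conj'.2 s3) fun n => ?_
    rw [hsym (n - 1)]
    simp
  have s5 : HasSum (fun n : ℕ => (Real.sqrt n : ℂ) * fockEntry (T 0 1) (n - 1) n) k := by
    refine hasSum_of_succ (by simp) ?_
    simpa using hk
  have s6 := (hg.mul_left α).add (s5.mul_left β)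
  rw [← hw] at s6
  have s7 := Complex.hasSum_conj'.2 s6
  have s8 := ((((s1.mul_left (α * conj α)).add (s2.mul_left (β * conj β))).add
    ((s3.mul_left (α * conj β)).add (s4.mul_left (conj α * β)))).sub
    (s6.mul_left (conj w))).add ((hD.mul_left (w * conj w)).sub (s7.mul_left w))
  refine (HasSum.nonneg (fun n => ?_) s8).trans_eq ?_
  swap
  · ring
  · -- test the block positivity on `L†|n⟩` and on `z|n⟩`, where the choice `z = -conj w`
    -- minimizes the sum over `n`
    have := blockPositive_two_iff.1 h
      ((conj α * Real.sqrt (n + 1)) • ket (n + 1) + (conj β * Real.sqrt n) • ket (n - 1))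
      ((-conj w) • ket n)
    rw [h.inner_one_zero] at this
    have e1 := ofReal_sqrt_mul_self (x := (n : ℝ) + 1) (by positivity)
    have e2 := ofReal_sqrt_mul_self (x := (n : ℝ)) (by positivity)
    push_cast at e1 e2
    convert this using 1
    simp only [map_add, map_smul, map_neg, map_mul, inner_add_left, inner_add_right,
      inner_smul_left, inner_smul_right, Complex.conj_conj, Complex.conj_ofReal, fockEntry]
    linear_combination
      (-α * conj α * ⟪ket (n + 1), (T 0 0).1 (ket (n + 1))⟫_ℂ) * e1
      + (-β * conj β * ⟪ket (n - 1), (T 0 0).1 (ket (n - 1))⟫_ℂ) * e2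

end Moments

/-! ### The block of outputs of a channel -/

/-- The outputs of a channel on the matrix units `|i⟩⟨j|`, `i, j = 0, 1`, arranged in a block
operator. -/
noncomputable def Channel.block (N : Channel) (i j : Fin 2) : TraceClass := N.map (ketbra i j)

theorem Channel.block_positive (N : Channel) : BlockPositive N.block := by
  refine N.completelyPositive 2 (fun i j => ketbra i j) (blockPositive_two_iff.2 fun u v => ?_)
  have h : 0 ≤ (⟪u, ket 0⟫_ℂ + ⟪v, ket 1⟫_ℂ) * conj (⟪u, ket 0⟫_ℂ + ⟪v, ket 1⟫_ℂ) :=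
    mul_star_self_nonneg _
  convert h using 1
  simp only [ketbra, InnerProductSpace.rankOne_apply, inner_smul_right, map_add,
    inner_conj_symm, Fin.val_zero, Fin.val_one]
  ring

theorem norm_ket (n : ℕ) : ‖ket n‖ = 1 := by
  simp [ket]

theorem trace_ketbra_self (m : ℕ) : trace (ketbra m m) = 1 := by
  rw [trace, tsum_eq_single m fun n hn => ?_]
  · simp [ketbra, norm_ket]
  · simp [ketbra, inner_ket_of_ne hn]

theorem Channel.hasSum_block (N : Channel) (i : Fin 2) :
    HasSum (fun n : ℕ => fockEntry (N.block i i) n n) 1 := by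
  have h : ∑' n : ℕ, fockEntry (N.block i i) n n = 1 :=
    (N.tracePreserving _).trans (trace_ketbra_self _)
  -- a series that is not summable has `tsum` equal to `0`
  have hs : Summable fun n : ℕ => fockEntry (N.block i i) n n := by
    by_contra hs
    simp [tsum_eq_zero_of_not_summable hs] at h
  exact h ▸ hs.hasSum

/-! ### Moments of the quadratures -/

theorem quadrature_zero :
    quadrature 0 = (1 / (Real.sqrt 2 : ℂ)) • (annihilation + creation) := rfl

theorem quadrature_one :
    quadrature 1 = (1 / (Complex.I * (Real.sqrt 2 : ℂ))) • (annihilation - creation) := rfl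

/-- Differences of operators on `FiniteFock` in terms of scalar multiples: the additive group
structure found on these endomorphisms does not unify with the one in the generic ring lemmas
on subtraction. -/
theorem end_sub_eq_add_smul (A B : Module.End ℂ FiniteFock) : A - B = A + (-1 : ℂ) • B :=
  LinearMap.ext fun v => by
    change A v - B v = A v + (-1 : ℂ) • B v
    module

theorem hasTrace_quadrature {T : TraceClass} {g k : ℂ} (hg : HasTrace T annihilation g)
    (hk : HasTrace T creation k) (j : Fin 2) :
    HasTrace T (quadrature j) (![1 / (Real.sqrt 2 : ℂ) * (g + k),
      1 / (Complex.I * (Real.sqrt 2 : ℂ)) * (g - k)] j) := by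
  fin_cases j
  · exact (hg.add hk).smul _
  · exact (hg.sub hk).smul _

theorem sqrt_two_mul_self : (Real.sqrt 2 : ℂ) * (Real.sqrt 2 : ℂ) = 2 := by
  simpa using ofReal_sqrt_mul_self (x := 2) (by norm_num)

theorem sqrt_two_ne_zero : (Real.sqrt 2 : ℂ) ≠ 0 := by simp

/-- The matrix `X` when `g = Tr[N(|0⟩⟨1|) a]` and `k = Tr[N(|0⟩⟨1|) a†]`. -/
def gaussX (g k : ℂ) : Matrix (Fin 2) (Fin 2) ℝ :=
  !![(g + k).re, (g + k).im; (g - k).im, -(g - k).re]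

/-- The matrix `V` of a centered state `ρ` with `p = Tr[ρ a†a]` and `q = Tr[ρ a²]`. -/
def gaussV (p : ℝ) (q : ℂ) : Matrix (Fin 2) (Fin 2) ℝ :=
  !![2 * q.re + 2 * p + 1, 2 * q.im; 2 * q.im, -2 * q.re + 2 * p + 1]

/-- The traces of the quadratures against the outputs on the transition operators are the entries
of `gaussX`; they are real because `N(|1⟩⟨0|)` is the adjoint of `N(|0⟩⟨1|)`. -/
theorem hasTrace_transition {N : Channel} {g k : ℂ}
    (hg : HasTrace (N.block 0 1) annihilation g) (hk : HasTrace (N.block 0 1) creation k)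
    (hg' : HasTrace (N.block 1 0) annihilation (conj k))
    (hk' : HasTrace (N.block 1 0) creation (conj g)) (i j : Fin 2) :
    HasTrace (N.map (transition j)) ((1 / (Real.sqrt 2 : ℂ)) • quadrature i)
      (gaussX g k i j : ℂ) := by
  have e0 : N.map (transition 0) = N.block 0 1 + N.block 1 0 := map_add _ _ _
  have e1 : N.map (transition 1) = (-Complex.I) • N.block 0 1 + Complex.I • N.block 1 0 := by
    simp [transition, Channel.block]
  have h01 := hasTrace_quadrature hg hk
  have h10 := hasTrace_quadrature hg' hk'
  have hr := sqrt_two_mul_self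
  have hr0 := sqrt_two_ne_zero
  have hI : Complex.I ^ 2 = -1 := Complex.I_sq
  revert i j
  simp only [Fin.forall_fin_two, e0, e1]
  refine ⟨⟨?_, ?_⟩, ?_, ?_⟩
  · convert ((h01 0).add_state (h10 0)).smul _ using 1
    simp [gaussX, Complex.re_eq_add_conj]
    field_simp
    linear_combination (g + k + conj g + conj k) * hr
  · convert (((h01 0).smul_state _).add_state ((h10 0).smul_state _)).smul _ using 1
    simp [gaussX, Complex.im_eq_sub_conj]
    field_simp
    linear_combination (g + k - conj g - conj k) * hr
      - 2 * (conj g + conj k - g - k) * hI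
  · convert ((h01 1).add_state (h10 1)).smul _ using 1
    simp [gaussX, Complex.im_eq_sub_conj]
    field_simp
    linear_combination (g - k - conj g + conj k) * hr + 2 * (g - k - conj g + conj k) * hI
  · convert (((h01 1).smul_state _).add_state ((h10 1).smul_state _)).smul _ using 1
    simp [gaussX, Complex.re_eq_add_conj]
    field_simp
    linear_combination (k + conj k - g - conj g) * (hr + 2 * hI)

theorem hasTrace_anticommutator {T : TraceClass} {p : ℝ} {q : ℂ}
    (h1 : HasTrace T (creation * annihilation) p)
    (h2 : HasTrace T (annihilation * creation) (p + 1))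
    (h3 : HasTrace T (annihilation * annihilation) q)
    (h4 : HasTrace T (creation * creation) (conj q)) (i j : Fin 2) :
    HasTrace T (quadrature i * quadrature j + quadrature j * quadrature i)
      (gaussV p q i j : ℂ) := by
  have hr := sqrt_two_mul_self
  have hr0 := sqrt_two_ne_zero
  have hI : Complex.I ^ 2 = -1 := Complex.I_sq
  have hxx : HasTrace T (quadrature 0 * quadrature 0) (q.re + p + 1 / 2) := by
    convert (((h3.add h4).add (h1.add h2)).smul (1 / 2 : ℂ)) using 1
    · simp only [quadrature_zero, smul_mul_smul_comm, one_div, ← mul_inv, hr]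
      congr 1
      noncomm_ring
    · rw [Complex.re_eq_add_conj]; ring
  have hpp : HasTrace T (quadrature 1 * quadrature 1) (-q.re + p + 1 / 2) := by
    convert (((h1.add h2).sub (h3.add h4)).smul (1 / 2 : ℂ)) using 1
    · have e : 1 / (Complex.I * (Real.sqrt 2 : ℂ)) * (1 / (Complex.I * (Real.sqrt 2 : ℂ)))
          = -(1 / 2 : ℂ) := by
        field_simp
        linear_combination 2 * hI + Complex.I ^ 2 * hr
      rw [quadrature_one, smul_mul_smul_comm, e]
      simp only [end_sub_eq_add_smul, mul_add, add_mul, smul_mul_assoc, mul_smul_comm]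
      module
    · rw [Complex.re_eq_add_conj]; ring
  have hxp : HasTrace T (quadrature 0 * quadrature 1 + quadrature 1 * quadrature 0)
      (2 * q.im) := by
    convert ((h3.sub h4).smul (1 / Complex.I)) using 1
    · have e : 1 / (Real.sqrt 2 : ℂ) * (1 / (Complex.I * (Real.sqrt 2 : ℂ)))
          = 1 / Complex.I * (1 / 2 : ℂ) := by
        field_simp
        linear_combination -hr
      rw [quadrature_zero, quadrature_one, smul_mul_smul_comm, smul_mul_smul_comm,
        mul_comm (1 / (Complex.I * _)), e, ← smul_add, mul_smul]
      congr 1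
      have : (annihilation + creation) * (annihilation - creation)
          + (annihilation - creation) * (annihilation + creation)
          = (2 : ℂ) • (annihilation * annihilation - creation * creation) := by
        simp only [end_sub_eq_add_smul, mul_add, add_mul, smul_mul_assoc, mul_smul_comm]
        module
      rw [this, smul_smul]; norm_num
    · rw [Complex.im_eq_sub_conj]; field_simp
  revert i j
  simp only [Fin.forall_fin_two]
  refine ⟨⟨?_, ?_⟩, ?_, ?_⟩
  · convert hxx.add hxx using 1
    simp [gaussV]; ring
  · convert hxp using 1
    simp [gaussV]
  · convert hxp using 1
    · exact add_comm _ _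
    · simp [gaussV]
  · convert hpp.add hpp using 1
    simp [gaussV]; ring

/-! ### The uncertainty relation -/

/-- The quadratic form of `Y + iΩ - iXΩXᵀ` at `c` is twice the defect in the Cauchy–Schwarz
inequality for the operator `L = c₀ x + c₁ p`: the matrix equals
`V + iΩ - X (1 + iΩ) Xᵀ`, where `V + iΩ` has entries `2 Tr[ρ Rⱼ Rₖ]` and `1 + iΩ` has rank one. -/
theorem posSemidef_gauss {p : ℝ} {q g k : ℂ}
    (h : ∀ α β : ℂ, 0 ≤ α * conj α * p + β * conj β * (p + 1)
      + (α * conj β * q + conj α * β * conj q) - (α * g + β * k) * conj (α * g + β * k)) :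
    (toComplex (gaussV p q - gaussX g k * (gaussX g k).transpose)
      + Complex.I • toComplex Omega
      - Complex.I • (toComplex (gaussX g k) * toComplex Omega
            * (toComplex (gaussX g k)).transpose)).PosSemidef := by
  have hM (i j : Fin 2) : (toComplex (gaussV p q - gaussX g k * (gaussX g k).transpose)
      + Complex.I • toComplex Omega
      - Complex.I • (toComplex (gaussX g k) * toComplex Omega
            * (toComplex (gaussX g k)).transpose)) i j
      = gaussV p q i j - (gaussX g k i 0 * gaussX g k j 0 + gaussX g k i 1 * gaussX g k j 1)
        + Complex.I * Omega i j
        - Complex.I * (gaussX g k i 0 * gaussX g k j 1 - gaussX g k i 1 * gaussX g k j 0) := by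
    simp only [toComplex, Matrix.sub_apply, Matrix.add_apply, Matrix.smul_apply,
      Matrix.map_apply, Matrix.mul_apply, Fin.sum_univ_two, Matrix.transpose_apply, smul_eq_mul,
      Complex.ofReal_sub, Complex.ofReal_add, Complex.ofReal_mul]
    simp [Omega]
    ring
  refine Matrix.PosSemidef.of_dotProduct_mulVec_nonneg ?_ fun c => ?_
  · refine Matrix.IsHermitian.ext fun i j => ?_
    rw [hM, hM]
    revert i j
    simp [Fin.forall_fin_two, Omega, gaussX, gaussV]
    refine ⟨⟨?_, ?_⟩, ?_, ?_⟩ <;> ring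
  · -- `c₀ x + c₁ p = (α a + β a†) / √2` with these `α` and `β`
    have h2 := h (c 0 - Complex.I * c 1) (c 0 + Complex.I * c 1)
    convert h2 using 1
    simp only [dotProduct, Matrix.mulVec, Fin.sum_univ_two, hM]
    simp [Omega, gaussX, gaussV, Complex.re_eq_add_conj, Complex.im_eq_sub_conj]
    field_simp
    ring_nf
    simp only [Complex.I_sq, Complex.I_pow_three, Complex.I_pow_four]
    ring

end Bosonic

open Bosonic

theorem mainTheorem2 (N : Bosonic.Channel) (hcentered : N.IsCentered)
    (hsecond : Bosonic.HasFiniteMoment 2 (N.map (Bosonic.ketbra 0 0)))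
    (hfirst : Bosonic.HasFiniteMoment 1 (N.map (Bosonic.ketbra 1 0))) :
    (∃ X Y : Matrix (Fin 2) (Fin 2) ℝ, N.HasGaussificationMatrices X Y) ∧
    ∀ X Y : Matrix (Fin 2) (Fin 2) ℝ, N.HasGaussificationMatrices X Y →
      (Bosonic.toComplex Y + Complex.I • Bosonic.toComplex Bosonic.Omega
        - Complex.I • (Bosonic.toComplex X * Bosonic.toComplex Bosonic.Omega
            * (Bosonic.toComplex X).transpose)).PosSemidef := by
  have hB := N.block_positive
  have h0 := N.hasSum_block 0
  have hD := N.hasSum_block 1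
  have hE : Summable fun n : ℕ => (n : ℝ) * ‖fockEntry (N.block 0 0) n n‖ := by
    simpa [HasFiniteMoment, fockEntry, Channel.block] using hsecond
  have ⟨p, hp⟩ := hE
  replace hp : HasSum (fun n : ℕ => (n : ℂ) * fockEntry (N.block 0 0) n n) (p : ℂ) := by
    refine HasSum.congr_fun (Complex.hasSum_ofReal.2 hp) fun n => ?_
    rw [Complex.ofReal_mul, fockEntry, Complex.norm_of_nonneg' (hB.zero_zero_nonneg _)]
    simp
  obtain ⟨g, hg⟩ := hB.summable_annihilation hE hD.summable
  obtain ⟨k, hk⟩ := hB.summable_creation hE h0.summable hD.summable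
  obtain ⟨q, hq⟩ := hB.summable_annihilation_sq hE h0.summable
  have hg' : HasTrace (N.block 1 0) annihilation (conj k) := by
    refine hasTrace_annihilation (HasSum.congr_fun (Complex.hasSum_conj'.2 hk) fun n => ?_)
    simp [hB.fockEntry_one_zero]
  have hk' : HasTrace (N.block 1 0) creation (conj g) := by
    refine hasTrace_creation (HasSum.congr_fun (Complex.hasSum_conj'.2 hg) fun n => ?_)
    simp [hB.fockEntry_one_zero]
  have hq' : HasTrace (N.block 0 0) (creation * creation) (conj q) := by
    refine hasTrace_creation_mul_creation
      (HasSum.congr_fun (Complex.hasSum_conj'.2 hq) fun n => ?_)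
    rw [hB.const_zero_zero.fockEntry_one_zero n (n + 2)]
    simp
  have hX := hasTrace_transition (hasTrace_annihilation hg) (hasTrace_creation hk) hg' hk'
  have hV := hasTrace_anticommutator (hasTrace_creation_mul_annihilation hp)
    (hasTrace_annihilation_mul_creation (by simpa [add_mul] using hp.add h0))
    (hasTrace_annihilation_mul_annihilation hq) hq'
  have hsub (A : Module.End ℂ FiniteFock) (i : Fin 2) :
      A - (((0 : Fin 2 → ℝ) i : ℝ) : ℂ) • 1 = A := by
    simp [end_sub_eq_add_smul]
  refine ⟨⟨gaussX g k, _, hX, gaussV p q, ⟨0, hcentered, fun i j => ?_⟩, rfl⟩, ?_⟩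
  · rw [hsub, hsub]
    exact hV i j
  · rintro X Y ⟨hX', V, ⟨d, hd, hV'⟩, rfl⟩
    have eX : X = gaussX g k := by
      ext i j
      exact_mod_cast (hX' i j).unique (hX i j)
    have ed : d = 0 := by
      ext i
      exact_mod_cast (hd i).unique (hcentered i)
    have eV : V = gaussV p q := by
      ext i j
      subst ed
      have h := hV' i j
      rw [hsub, hsub] at h
      exact Complex.ofReal_injective (h.unique (hV i j))
    rw [eX, eV]
    exact posSemidef_gauss fun α β => hB.moment_inequality α β h0 hD hp hq hg hk
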